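/- Let $n,p\ge 0$ be integers, fix $\lambda>0$, and let $X\in\mathbb{R}^{n\times p}$ and $y\in\mathbb{R}^n$ be random with a joint distribution that is absolutely continuous with respect to $(np+n)$-dimensional Lebesgue measure. Then, almost surely, the generalized lasso problem $$\underset{\beta\in\mathbb{R}^p}{\mathrm{minimize}}\;\; \tfrac12\|y-X\beta\|_2^2+\lambda\|D\beta\|_1$$ has exactly one solution, in each of the following cases ($k\ge 0$ denotes an integer; a matrix whose stated number of rows would be negative is understood to have no rows). (i) $D=I\in\mathbb{R}^{p\times p}$ is the identity matrix. (ii) $D=D^{(1)}_p\in\mathbb{R}^{(p-1)\times p}$ is the first difference matrix (fused lasso), $(D^{(1)}_p\beta)_i=\beta_{i+1}-\beta_i$, and $n\ge 1$. (iii) $D=D^{(k+1)}_p\in\mathbb{R}^{(p-k-1)\times p}$ is the $(k+1)$st order difference matrix ($k$th order trend filtering), defined by $D^{(j+1)}_p=D^{(1)}_{p-j}D^{(j)}_p$ for $j\ge1$, and $n\ge k+1$. (iv) $D=\Delta\in\mathbb{R}^{m\times p}$ is the graph fused lasso matrix of an undirected simple graph with $p$ nodes, $m$ edges and $r$ connected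 components, i.e., an oriented incidence matrix (one row for each edge, with $-1$ at one endpoint, $+1$ at the other, and $0$ elsewhere; the orientation of the edges and the order of the rows are arbitrary), and $n\ge r$. (v) $D$ is the $k$th order graph trend filtering matrix of such a graph, i.e., $D=\Delta(\Delta^T\Delta)^{k/2}\in\mathbb{R}^{m\times p}$ if $k$ is even and $D=(\Delta^T\Delta)^{(k+1)/2}\in\mathbb{R}^{p\times p}$ if $k$ is odd, and $n\ge r$. (vi) $p=N^d$, the coordinates of $\beta$ are indexed by the points of the $d$-dimensional grid $\{1,\dots,N\}^d$, $D\in\mathbb{R}^{(N-k-1)N^{d-1}d\times N^d}$ is the $k$th order Kronecker trend filtering matrix, obtained by stacking the $d$ matrices $I_N\otimes\cdots\otimes I_N\otimes D^{(k+1)}_N\otimes I_N\otimes\cdots\otimes I_N$ ($d$ factors, with $D^{(k+1)}_N$ in position $j$, for $j=1,\dots,d$), and $n\ge (k+1)^d$. -/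

import Mathlib

open MeasureTheory

/-- The generalized lasso criterion `(1/2) ‖y - X β‖₂² + lam ‖D β‖₁`. -/
noncomputable def genLassoCriterion {n p : ℕ} {ρ : Type*} [Fintype ρ] (lam : ℝ)
    (X : Matrix (Fin n) (Fin p) ℝ) (y : Fin n → ℝ) (D : Matrix ρ (Fin p) ℝ)
    (β : Fin p → ℝ) : ℝ :=
  (1 / 2) * ∑ i, (y i - X.mulVec β i) ^ 2 + lam * ∑ l, |D.mulVec β l|

/-- `β` is a solution of the generalized lasso problem: a global minimizer of the criterion. -/
def IsGenLassoSolution {n p : ℕ} {ρ : Type*} [Fintype ρ] (lam : ℝ)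
    (X : Matrix (Fin n) (Fin p) ℝ) (y : Fin n → ℝ) (D : Matrix ρ (Fin p) ℝ)
    (β : Fin p → ℝ) : Prop :=
  ∀ β' : Fin p → ℝ, genLassoCriterion lam X y D β ≤ genLassoCriterion lam X y D β'

/-- The problem with data `X`, `y` and penalty `D` has exactly one solution. -/
def HasUniqueGenLassoSolution {n p : ℕ} {ρ : Type*} [Fintype ρ] (lam : ℝ)
    (X : Matrix (Fin n) (Fin p) ℝ) (y : Fin n → ℝ) (D : Matrix ρ (Fin p) ℝ) : Prop :=
  ∃! β : Fin p → ℝ, IsGenLassoSolution lam X y D β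

/-- The `(p - 1) × p` first difference matrix: row `i` is `-1` in column `i`, `1` in column
`i + 1`, and `0` elsewhere, so that `(D β) i = β (i + 1) - β i`. -/
def firstDiffMatrix (p : ℕ) : Matrix (Fin (p - 1)) (Fin p) ℝ :=
  Matrix.of fun i j =>
    if j.val = i.val then -1 else if j.val = i.val + 1 then 1 else 0

/-- The `(p - k - 1) × p` difference matrix of order `k + 1`, i.e. the penalty matrix of
trend filtering of order `k`: the product of `k + 1` first difference matrices of
decreasing sizes. (It has no rows if `p ≤ k + 1`.) -/
def trendFilterMatrix (p : ℕ) : (k : ℕ) → Matrix (Fin (p - k - 1)) (Fin p) ℝ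
  | 0 => firstDiffMatrix p
  | k + 1 => firstDiffMatrix (p - k - 1) * trendFilterMatrix p k

/-- `D` is a graph fused lasso penalty matrix (oriented incidence matrix) of the graph `G`:
its rows are in bijection with the edges of `G`, and the row of an edge is `-1` at one
endpoint, `1` at the other, and `0` elsewhere. The order of the rows and the orientation of
the edges are arbitrary. -/
def IsGraphFusedLassoMatrix {m p : ℕ} (G : SimpleGraph (Fin p))
    (D : Matrix (Fin m) (Fin p) ℝ) : Prop :=
  ∃ tail head : Fin m → Fin p,
    Function.Injective (fun l => s(tail l, head l)) ∧
    Set.range (fun l => s(tail l, head l)) = G.edgeSet ∧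
    ∀ l v, D l v = (if v = head l then 1 else 0) - (if v = tail l then 1 else 0)

/-- Number of rows of the graph trend filtering matrix of order `k` of a graph with `m` edges
and `p` nodes: `m` if `k` is even, and `p` if `k` is odd. -/
def graphTrendFilterRows : (m p k : ℕ) → ℕ
  | m, _, 0 => m
  | m, p, k + 1 => graphTrendFilterRows p m k

/-- The graph trend filtering matrix of order `k`, built from an oriented incidence matrix `Δ`:
the alternating product `⋯ Δᵀ * Δ` with `k + 1` factors, i.e. `Δ`, `Δᵀ * Δ`, `Δ * Δᵀ * Δ`, …
for `k = 0, 1, 2, …`. With the graph Laplacian `L = Δᵀ * Δ` this is `Δ * L ^ (k / 2)` for even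
`k` and `L ^ ((k + 1) / 2)` for odd `k`. -/
def graphTrendFilterMatrix : {m p : ℕ} → (Δ : Matrix (Fin m) (Fin p) ℝ) → (k : ℕ) →
    Matrix (Fin (graphTrendFilterRows m p k)) (Fin p) ℝ
  | _, _, Δ, 0 => Δ
  | _, _, Δ, k + 1 => graphTrendFilterMatrix Δ.transpose k * Δ

/-- The penalty matrix of Kronecker trend filtering of order `k` on the `d`-dimensional grid with
all side lengths `N`; its columns are labelled by the grid points. It stacks, for `j` in `Fin d`,
the blocks `I ⊗ ⋯ ⊗ I ⊗ T ⊗ I ⊗ ⋯ ⊗ I`, where `T` is the difference matrix of order `k + 1` on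
`N` points and stands in position `j`. A row of block `j` is labelled by a row `r.2.1` of `T`
and the coordinates `r.2.2` other than `j` of a grid point; in all there are
`d * (N - k - 1) * N ^ (d - 1)` rows. -/
def kroneckerTrendFilterMatrix (N d k : ℕ) :
    Matrix ((j : Fin d) × Fin (N - k - 1) × ({i : Fin d // i ≠ j} → Fin N))
      (Fin d → Fin N) ℝ :=
  Matrix.of fun r x =>
    trendFilterMatrix N k r.2.1 (x r.1) *
      ∏ i : {i : Fin d // i ≠ r.1}, (1 : Matrix (Fin N) (Fin N) ℝ) (r.2.2 i) (x i)

/-!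
Uniqueness holds for almost every design `X`, whatever `y` is, as soon as `dim ker D ≤ n`.

Two linear-algebra facts hold for almost every `X`. A fixed subspace `K` with `dim K ≤ n` meets
`ker X` trivially (`ae_injOn_of_finrank_le`): some design `X₀` is injective on `K`, and on each line
`Y + t X₀` the determinant certifying injectivity is a characteristic polynomial in `t`, so it
vanishes only finitely often. If instead `dim K > n`, then a fixed functional that is nonzero on
`K` is not a combination of the rows of `X` on `K` (`ae_not_mem_rowSpace_of_lt_finrank`).

Since `X` is injective on `ker D`, the criterion is coercive and a minimizer exists. If
`β₁` and `β₂` are both minimizers, so is their midpoint `β`; moreover `X (β₁ - β₂) = 0`, and `D (β₁ - β₂)`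
vanishes wherever `D β` does (`IsGenLassoSolution.midpoint`). Let `K` be the space of all `h` with
the latter property and `f h = ∑ sign (D β)_l (D h)_l`. On `K` the criterion is
differentiable at `β`, so stationarity writes `f` on `K` as a combination of the rows of `X`.
If `f` vanishes on `K`, then `f β = ‖D β‖₁` gives `D β = 0` and `K = ker D`, on which `X` is
injective. Otherwise genericity forces `dim K ≤ n`, and again `X` is injective on `K`. Either
way `β₁ = β₂`. Only the finitely many pairs `(K, f)` given by sign patterns occur, so one null set
of designs suffices (`ae_hasUniqueGenLassoSolution`).

It remains to bound the nullity of each penalty matrix, by exhibiting few coordinates that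
determine a vector of the kernel: the first `k + 1` points of the path, the corner cube of side
`k + 1` of the grid, or one node in each connected component of the graph.
-/

/-! ### Generic designs -/

/-- Almost every `n × p` matrix is injective on a given subspace of dimension at most `n`. -/
theorem ae_injOn_of_finrank_le {n p : ℕ} (K : Submodule ℝ (Fin p → ℝ))
    (hK : Module.finrank ℝ K ≤ n) :
    ∀ᵐ X : Fin n → Fin p → ℝ, ∀ h ∈ K, (Matrix.of X).mulVec h = 0 → h = 0 := by
  set q := Module.finrank ℝ K with hq
  let e : (Fin q → ℝ) ≃ₗ[ℝ] K := (Module.finBasis ℝ K).equivFun.symm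
  let ι : (Fin q → ℝ) →ₗ[ℝ] (Fin p → ℝ) := K.subtype ∘ₗ e.toLinearMap
  have hι : Function.Injective ι := K.injective_subtype.comp e.injective
  obtain ⟨Λ, hΛ⟩ := ι.exists_leftInverse_of_injective (LinearMap.ker_eq_bot.2 hι)
  let C : (Fin n → ℝ) →ₗ[ℝ] (Fin q → ℝ) := LinearMap.funLeft ℝ ℝ (Fin.castLE hK)
  have hC : Function.Surjective C :=
    LinearMap.funLeft_surjective_of_injective _ _ _ (Fin.castLE_injective hK)
  obtain ⟨E, hE⟩ := C.exists_rightInverse_of_surjective (LinearMap.range_eq_top.2 hC)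
  let Cm := LinearMap.toMatrix' C
  let Bm := LinearMap.toMatrix' ι
  let Xm : Matrix (Fin n) (Fin p) ℝ := LinearMap.toMatrix' (E ∘ₗ Λ)
  have hone : Cm * Xm * Bm = 1 := by
    simp only [Cm, Xm, Bm, ← LinearMap.toMatrix'_comp]
    rw [show (C ∘ₗ (E ∘ₗ Λ)) ∘ₗ ι = (C ∘ₗ E) ∘ₗ (Λ ∘ₗ ι) from rfl, hE, hΛ]
    simp
  -- Full rank of `X` on `K` is guaranteed where this determinant does not vanish.
  have hdet : ∀ᵐ X : Fin n → Fin p → ℝ,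
      X ∈ {X : Fin n → Fin p → ℝ | (Cm * Matrix.of X * Bm).det ≠ 0} := by
    let L : ℝ →ₗ[ℝ] (Fin n → Fin p → ℝ) := LinearMap.toSpanSingleton ℝ _ (Matrix.of.symm Xm)
    refine ae_mem_of_ae_add_linearMap_mem L volume volume ?_ ?_
    · have hcont : Continuous fun X : Fin n → Fin p → ℝ => (Cm * Matrix.of X * Bm).det := by
        have : Continuous fun X : Fin n → Fin p → ℝ => Matrix.of X := continuous_id
        fun_prop
      exact (isOpen_ne_fun hcont continuous_const).measurableSet
    · intro Y
      -- Along the line `Y + t X₀` the determinant is a characteristic polynomial in `t`.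
      have hfin := Polynomial.finite_setOfPred_isRoot
        (Matrix.charpoly_monic (-(Cm * Matrix.of Y * Bm))).ne_zero
      filter_upwards [hfin.countable.ae_notMem volume] with t ht
      intro h0
      refine ht ?_
      rw [Polynomial.IsRoot.def, Matrix.eval_charpoly, ← h0]
      congr 1
      have : Matrix.of (Y + L t) = Matrix.of Y + t • Xm := rfl
      rw [this, Matrix.mul_add, Matrix.add_mul, Matrix.mul_smul, Matrix.smul_mul, hone,
        sub_neg_eq_add, add_comm, Matrix.scalar_apply, Matrix.smul_one_eq_diagonal]
  filter_upwards [hdet] with X hX h hh hXh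
  have hv : Bm.mulVec (e.symm ⟨h, hh⟩) = h := by
    simp [Bm, ι]
  have h0 : (Cm * Matrix.of X * Bm).mulVec (e.symm ⟨h, hh⟩) = 0 := by
    rw [← Matrix.mulVec_mulVec, hv, ← Matrix.mulVec_mulVec, hXh, Matrix.mulVec_zero]
  have := Matrix.eq_zero_of_mulVec_eq_zero hX h0
  rw [← hv, this, Matrix.mulVec_zero]

theorem exists_submodule_le_finrank_eq {V : Type*} [AddCommGroup V] [Module ℝ V] {n : ℕ}
    (K : Submodule ℝ V) (hK : n ≤ Module.finrank ℝ K) :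
    ∃ M ≤ K, Module.finrank ℝ M = n := by
  obtain ⟨v, hv⟩ := exists_linearIndependent_of_le_finrank hK
  refine ⟨(Submodule.span ℝ (Set.range v)).map K.subtype, Submodule.map_subtype_le _ _, ?_⟩
  rw [Submodule.finrank_map_subtype_eq, finrank_span_eq_card hv, Fintype.card_fin]

theorem finrank_le_finrank_inf_ker_add_one {V : Type*} [AddCommGroup V] [Module ℝ V]
    [FiniteDimensional ℝ V] (K : Submodule ℝ V) (f : V →ₗ[ℝ] ℝ) :
    Module.finrank ℝ K ≤ Module.finrank ℝ ↥(K ⊓ LinearMap.ker f) + 1 := by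
  have h1 := (f.domRestrict K).finrank_range_add_finrank_ker
  have h2 : Module.finrank ℝ (LinearMap.range (f.domRestrict K)) ≤ 1 := by
    simpa using (LinearMap.range (f.domRestrict K)).finrank_le
  have h3 : (LinearMap.ker (f.domRestrict K)).map K.subtype ≤ K ⊓ LinearMap.ker f := by
    rintro _ ⟨a, ha, rfl⟩
    exact ⟨a.2, ha⟩
  have h4 := Submodule.finrank_mono h3
  rw [Submodule.finrank_map_subtype_eq] at h4
  omega

/-- Almost every `X` is injective on some fixed `n`-dimensional `M ≤ K ⊓ ker f`, hence maps it onto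
`ℝⁿ`; a combination of the rows of `X` that equals `f` on `K` vanishes on `M`, so all its
coefficients are zero. -/
theorem ae_not_mem_rowSpace_of_lt_finrank {n p : ℕ} (K : Submodule ℝ (Fin p → ℝ))
    (hK : n < Module.finrank ℝ K) (f : (Fin p → ℝ) →ₗ[ℝ] ℝ) (hf : ∃ h ∈ K, f h ≠ 0) :
    ∀ᵐ X : Fin n → Fin p → ℝ,
      ¬ ∃ r : Fin n → ℝ, ∀ h ∈ K, r ⬝ᵥ (Matrix.of X).mulVec h = f h := by
  obtain ⟨M, hMle, hM⟩ := exists_submodule_le_finrank_eq (n := n) (K ⊓ LinearMap.ker f)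
    (by have := finrank_le_finrank_inf_ker_add_one K f; omega)
  filter_upwards [ae_injOn_of_finrank_le M hM.le] with X hX
  rintro ⟨r, hr⟩
  -- `X` maps the `n`-dimensional space `M` onto `ℝⁿ`, and `r` is orthogonal to its image.
  let T : M →ₗ[ℝ] (Fin n → ℝ) := (Matrix.of X).mulVecLin ∘ₗ M.subtype
  have hT : Function.Injective T := by
    refine (injective_iff_map_eq_zero T).2 fun a ha => ?_
    exact Subtype.ext (hX a a.2 ha)
  have hTs : Function.Surjective T :=
    (LinearMap.injective_iff_surjective_of_finrank_eq_finrank (by simp [hM])).1 hT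
  obtain ⟨a, ha⟩ := hTs r
  have hr0 : r = 0 := by
    have h1 := hr a (hMle a.2).1
    rw [show (Matrix.of X).mulVec a = r from ha, show f a = 0 from (hMle a.2).2] at h1
    exact dotProduct_self_eq_zero.1 h1
  obtain ⟨h, hh, hne⟩ := hf
  exact hne (by rw [← hr h hh, hr0, zero_dotProduct])

/-! ### Existence and convexity -/

section GenLasso

variable {n p : ℕ} {ρ : Type*} [Fintype ρ] {lam : ℝ}
  {X : Matrix (Fin n) (Fin p) ℝ} {y : Fin n → ℝ} {D : Matrix ρ (Fin p) ℝ}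

/-- The criterion dominates a multiple of `‖(X β, D β)‖` up to a constant, and `β ↦ (X β, D β)`
is injective and linear, so the criterion is coercive. -/
theorem tendsto_genLassoCriterion_cocompact (hlam : 0 < lam)
    (hker : ∀ h, D.mulVec h = 0 → X.mulVec h = 0 → h = 0) :
    Filter.Tendsto (genLassoCriterion lam X y D) (Filter.cocompact _) Filter.atTop := by
  let T : (Fin p → ℝ) →ₗ[ℝ] (Fin n → ℝ) × (ρ → ℝ) := X.mulVecLin.prod D.mulVecLin
  have hT : LinearMap.ker T = ⊥ := by
    refine LinearMap.ker_eq_bot'.2 fun h hh => ?_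
    have := Prod.ext_iff.1 hh
    exact hker h this.2 this.1
  obtain ⟨K, -, hK⟩ := T.exists_antilipschitzWith hT
  have hTt : Filter.Tendsto (fun β => ‖T β‖) (Filter.cocompact _) Filter.atTop := by
    rw [← Metric.cobounded_eq_cocompact]
    exact tendsto_norm_cobounded_atTop.comp hK.tendsto_cobounded
  have hc : 0 < min 1 lam := lt_min one_pos hlam
  refine Filter.tendsto_atTop_mono (fun β => ?_) (Filter.tendsto_atTop_add_const_right _
    (-(∑ i, (|y i| + 1 / 2))) (hTt.const_mul_atTop hc))
  have hX : ‖X.mulVec β‖ ≤ ∑ i, |X.mulVec β i| := by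
    refine (pi_norm_le_iff_of_nonneg (Finset.sum_nonneg fun _ _ => abs_nonneg _)).2 fun i => ?_
    exact Finset.single_le_sum (f := fun i => |X.mulVec β i|) (fun _ _ => abs_nonneg _)
      (Finset.mem_univ i)
  have hD : ‖D.mulVec β‖ ≤ ∑ l, |D.mulVec β l| := by
    refine (pi_norm_le_iff_of_nonneg (Finset.sum_nonneg fun _ _ => abs_nonneg _)).2 fun i => ?_
    exact Finset.single_le_sum (f := fun i => |D.mulVec β i|) (fun _ _ => abs_nonneg _)
      (Finset.mem_univ i)
  have hTn : ‖T β‖ ≤ ‖X.mulVec β‖ + ‖D.mulVec β‖ :=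
    max_le (le_add_of_nonneg_right (norm_nonneg _)) (le_add_of_nonneg_left (norm_nonneg _))
  -- `a ^ 2 / 2 ≥ |a| - 1 / 2` bounds the squared loss below by an `ℓ¹` loss.
  have hsq : ∑ i, |X.mulVec β i| ≤
      (1 / 2) * ∑ i, (y i - X.mulVec β i) ^ 2 + ∑ i, (|y i| + 1 / 2) := by
    rw [Finset.mul_sum, ← Finset.sum_add_distrib]
    refine Finset.sum_le_sum fun i _ => ?_
    have h1 := abs_sub_abs_le_abs_sub (X.mulVec β i) (y i)
    rw [abs_sub_comm] at h1
    nlinarith [sq_nonneg (|y i - X.mulVec β i| - 1), sq_abs (y i - X.mulVec β i)]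
  have h1 : min 1 lam * ‖T β‖ ≤ 1 * ‖X.mulVec β‖ + lam * ‖D.mulVec β‖ := by
    calc min 1 lam * ‖T β‖ ≤ min 1 lam * (‖X.mulVec β‖ + ‖D.mulVec β‖) := by gcongr
      _ ≤ _ := by
        rw [mul_add]
        gcongr
        · exact min_le_left _ _
        · exact min_le_right _ _
  have h2 := mul_le_mul_of_nonneg_left hD hlam.le
  unfold genLassoCriterion
  linarith

theorem exists_isGenLassoSolution (hlam : 0 < lam)
    (hker : ∀ h, D.mulVec h = 0 → X.mulVec h = 0 → h = 0) :
    ∃ β, IsGenLassoSolution lam X y D β := by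
  have hcont : Continuous (genLassoCriterion lam X y D) := by
    unfold genLassoCriterion
    fun_prop
  exact hcont.exists_forall_le (tendsto_genLassoCriterion_cocompact hlam hker)

/-- Strict convexity of the squared loss makes the fits of two solutions agree; additivity of
the absolute values at the midpoint excludes cancellation in `D`. -/
theorem IsGenLassoSolution.midpoint {β₁ β₂ : Fin p → ℝ} (hlam : 0 < lam)
    (h₁ : IsGenLassoSolution lam X y D β₁) (h₂ : IsGenLassoSolution lam X y D β₂) :
    IsGenLassoSolution lam X y D ((1 / 2 : ℝ) • (β₁ + β₂)) ∧
      X.mulVec (β₁ - β₂) = 0 ∧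
      ∀ l, D.mulVec ((1 / 2 : ℝ) • (β₁ + β₂)) l = 0 → D.mulVec (β₁ - β₂) l = 0 := by
  set β := (1 / 2 : ℝ) • (β₁ + β₂) with hβ
  have hXβ : ∀ i, X.mulVec β i = (X.mulVec β₁ i + X.mulVec β₂ i) / 2 := fun i => by
    simp [hβ, Matrix.mulVec_smul, Matrix.mulVec_add]; ring
  have hDβ : ∀ l, D.mulVec β l = (D.mulVec β₁ l + D.mulVec β₂ l) / 2 := fun i => by
    simp [hβ, Matrix.mulVec_smul, Matrix.mulVec_add]; ring
  have heq : genLassoCriterion lam X y D β₁ = genLassoCriterion lam X y D β₂ :=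
    le_antisymm (h₁ _) (h₂ _)
  let a : Fin n → ℝ := fun i => (X.mulVec β₁ i - X.mulVec β₂ i) ^ 2
  let b : ρ → ℝ := fun l =>
    (|D.mulVec β₁ l| + |D.mulVec β₂ l|) / 2 - |D.mulVec β l|
  have ha : ∀ i, 0 ≤ a i := fun i => sq_nonneg _
  have hb : ∀ l, 0 ≤ b l := fun l => by
    have := abs_add_le (D.mulVec β₁ l) (D.mulVec β₂ l)
    simp only [b, hDβ, abs_div, abs_two]
    linarith
  -- The exact convexity defect of the criterion at the midpoint.
  have hid : genLassoCriterion lam X y D β + (1 / 8 * ∑ i, a i + lam * ∑ l, b l) =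
      genLassoCriterion lam X y D β₁ := by
    have hs : ∑ i, (y i - X.mulVec β i) ^ 2 = (1 / 2) * ∑ i, (y i - X.mulVec β₁ i) ^ 2 +
        (1 / 2) * ∑ i, (y i - X.mulVec β₂ i) ^ 2 - 1 / 4 * ∑ i, a i := by
      simp only [Finset.mul_sum, ← Finset.sum_add_distrib, ← Finset.sum_sub_distrib]
      refine Finset.sum_congr rfl fun i _ => ?_
      simp only [a, hXβ]
      ring
    have ht : ∑ l, b l = (∑ l, |D.mulVec β₁ l| + ∑ l, |D.mulVec β₂ l|) / 2 -
        ∑ l, |D.mulVec β l| := by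
      simp only [b, Finset.sum_sub_distrib, ← Finset.sum_div, Finset.sum_add_distrib]
    have h3 : genLassoCriterion lam X y D β₁ =
        (genLassoCriterion lam X y D β₁ + genLassoCriterion lam X y D β₂) / 2 := by
      rw [← heq]; ring
    rw [h3]
    unfold genLassoCriterion
    rw [hs, ht]
    ring
  have hA : 0 ≤ ∑ i, a i := Finset.sum_nonneg fun i _ => ha i
  have hB : 0 ≤ lam * ∑ l, b l := mul_nonneg hlam.le (Finset.sum_nonneg fun l _ => hb l)
  have hle := h₁ β
  have hA0 : ∑ i, a i = 0 := by linarith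
  have hB0 : ∑ l, b l = 0 := by
    have : lam * ∑ l, b l = 0 := by linarith
    exact (mul_eq_zero.1 this).resolve_left hlam.ne'
  refine ⟨fun β' => by have := h₁ β'; linarith, ?_, fun l hl => ?_⟩
  · ext i
    have := (Finset.sum_eq_zero_iff_of_nonneg fun i _ => ha i).1 hA0 i (Finset.mem_univ i)
    simpa [a, Matrix.mulVec_sub] using this
  · have := (Finset.sum_eq_zero_iff_of_nonneg fun l _ => hb l).1 hB0 l (Finset.mem_univ l)
    simp only [b, hl, abs_zero, sub_zero] at this
    have h1 := abs_nonneg (D.mulVec β₁ l)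
    have h2 := abs_nonneg (D.mulVec β₂ l)
    rw [Matrix.mulVec_sub, Pi.sub_apply, abs_eq_zero.1 (by linarith : |D.mulVec β₁ l| = 0),
      abs_eq_zero.1 (by linarith : |D.mulVec β₂ l| = 0), sub_zero]

/-- First-order optimality in the directions along which the zeros of `D β` persist: there the
penalty is differentiable at `β`. -/
theorem IsGenLassoSolution.stationary {β h : Fin p → ℝ}
    (hβ : IsGenLassoSolution lam X y D β)
    (hh : ∀ l, D.mulVec β l = 0 → D.mulVec h l = 0) :
    (y - X.mulVec β) ⬝ᵥ X.mulVec h =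
      lam * ∑ l, (SignType.sign (D.mulVec β l) : ℝ) * D.mulVec h l := by
  have hmin : IsLocalMin (fun t : ℝ => genLassoCriterion lam X y D (β + t • h)) 0 :=
    Filter.Eventually.of_forall fun t => by simpa using hβ (β + t • h)
  have hderiv : HasDerivAt (fun t : ℝ => genLassoCriterion lam X y D (β + t • h))
      ((1 / 2) * ∑ i, (2 * (y i - X.mulVec β i) * -(X.mulVec h i)) +
        lam * ∑ l, (SignType.sign (D.mulVec β l) : ℝ) * D.mulVec h l) 0 := by
    simp only [genLassoCriterion, Matrix.mulVec_add, Matrix.mulVec_smul, Pi.add_apply,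
      Pi.smul_apply, smul_eq_mul]
    refine HasDerivAt.add (HasDerivAt.const_mul _ (HasDerivAt.fun_sum fun i _ => ?_))
      (HasDerivAt.const_mul _ (HasDerivAt.fun_sum fun l _ => ?_))
    · have h1 : HasDerivAt (fun t : ℝ => y i - (X.mulVec β i + t * X.mulVec h i))
          (-(X.mulVec h i)) 0 := by
        simpa using (((hasDerivAt_id (0 : ℝ)).mul_const (X.mulVec h i)).const_add
          (X.mulVec β i)).const_sub (y i)
      simpa using h1.fun_pow 2
    · by_cases hl : D.mulVec β l = 0
      · simpa [hl, hh l hl] using hasDerivAt_const (0 : ℝ) (0 : ℝ)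
      · have h1 : HasDerivAt (fun t : ℝ => D.mulVec β l + t * D.mulVec h l)
            (D.mulVec h l) 0 := by
          simpa using ((hasDerivAt_id (0 : ℝ)).mul_const (D.mulVec h l)).const_add
            (D.mulVec β l)
        have h2 : HasDerivAt (fun x : ℝ => |x|) (SignType.sign (D.mulVec β l) : ℝ)
            (D.mulVec β l + 0 * D.mulVec h l) := by
          simpa using hasDerivAt_abs hl
        exact h2.comp (0 : ℝ) h1
  have h0 := hmin.hasDerivAt_eq_zero hderiv
  have hs : (1 / 2) * ∑ i, (2 * (y i - X.mulVec β i) * -(X.mulVec h i)) =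
      -((y - X.mulVec β) ⬝ᵥ X.mulVec h) := by
    simp only [dotProduct, Finset.mul_sum, ← Finset.sum_neg_distrib, Pi.sub_apply]
    exact Finset.sum_congr rfl fun i _ => by ring
  linarith

end GenLasso

/-! ### Uniqueness for generic designs -/

/-- The vectors `h` such that `D h` vanishes wherever the sign pattern `σ` does. -/
def signFace {p : ℕ} {ρ : Type*} (D : Matrix ρ (Fin p) ℝ) (σ : ρ → SignType) :
    Submodule ℝ (Fin p → ℝ) where
  carrier := {h | ∀ l, σ l = 0 → D.mulVec h l = 0}
  add_mem' := fun ha hb l hl => by simp [Matrix.mulVec_add, ha l hl, hb l hl]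
  zero_mem' := fun l _ => by simp
  smul_mem' := fun c a ha l hl => by simp [Matrix.mulVec_smul, ha l hl]

/-- The functional `h ↦ ∑ l, σ l * (D h) l`; if `σ` is the sign pattern of `D β`, its value at `β`
is `‖D β‖₁`. -/
def signFunctional {p : ℕ} {ρ : Type*} [Fintype ρ] (D : Matrix ρ (Fin p) ℝ)
    (σ : ρ → SignType) : (Fin p → ℝ) →ₗ[ℝ] ℝ :=
  ∑ l, (σ l : ℝ) • (LinearMap.proj l ∘ₗ D.mulVecLin)

theorem signFunctional_apply {p : ℕ} {ρ : Type*} [Fintype ρ] (D : Matrix ρ (Fin p) ℝ)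
    (σ : ρ → SignType) (h : Fin p → ℝ) :
    signFunctional D σ h = ∑ l, (σ l : ℝ) * D.mulVec h l := by
  simp [signFunctional]

/-- Deterministic uniqueness: `hgen` demands of every sign pattern with a nonzero functional that
`X` be injective on its face, or that the functional be outside the row space of `X` there. -/
theorem hasUniqueGenLassoSolution_of_generic {n p : ℕ} {ρ : Type*} [Fintype ρ] {lam : ℝ}
    {X : Matrix (Fin n) (Fin p) ℝ} {y : Fin n → ℝ} {D : Matrix ρ (Fin p) ℝ} (hlam : 0 < lam)
    (hker : ∀ h, D.mulVec h = 0 → X.mulVec h = 0 → h = 0)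
    (hgen : ∀ σ : ρ → SignType, (∃ h ∈ signFace D σ, signFunctional D σ h ≠ 0) →
      (∀ h ∈ signFace D σ, X.mulVec h = 0 → h = 0) ∨
      ¬ ∃ r : Fin n → ℝ, ∀ h ∈ signFace D σ, r ⬝ᵥ X.mulVec h = signFunctional D σ h) :
    HasUniqueGenLassoSolution lam X y D := by
  obtain ⟨β₁, h₁⟩ := exists_isGenLassoSolution (y := y) hlam hker
  refine ⟨β₁, h₁, fun β₂ h₂ => ?_⟩
  obtain ⟨hβ, hX, hD⟩ := h₁.midpoint hlam h₂
  set β := (1 / 2 : ℝ) • (β₁ + β₂)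
  let σ : ρ → SignType := fun l => SignType.sign (D.mulVec β l)
  have hmem : ∀ h, h ∈ signFace D σ ↔ ∀ l, D.mulVec β l = 0 → D.mulVec h l = 0 := fun h =>
    forall_congr' fun l => by simp only [σ, sign_eq_zero_iff]
  have hsum : signFunctional D σ β = ∑ l, |D.mulVec β l| := by
    rw [signFunctional_apply]
    exact Finset.sum_congr rfl fun l _ => sign_mul_self _
  suffices β₁ - β₂ = 0 from (sub_eq_zero.1 this).symm
  by_cases hz : signFunctional D σ β = 0
  · -- If `D β = 0`, then `D (β₁ - β₂) = 0` as well.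
    refine hker _ (funext fun l => hD l ?_) hX
    rw [hsum] at hz
    exact abs_eq_zero.1 ((Finset.sum_eq_zero_iff_of_nonneg fun l _ => abs_nonneg _).1 hz l
      (Finset.mem_univ l))
  · rcases hgen σ ⟨β, (hmem β).2 fun l hl => hl, hz⟩ with hinj | hrow
    · exact hinj _ ((hmem _).2 hD) hX
    · refine absurd ⟨lam⁻¹ • (y - X.mulVec β), fun h hh => ?_⟩ hrow
      rw [smul_dotProduct, hβ.stationary ((hmem h).1 hh), signFunctional_apply, smul_eq_mul,
        inv_mul_cancel_left₀ hlam.ne']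

/-- A penalty matrix of nullity at most `n` gives a unique solution almost surely. -/
theorem ae_hasUniqueGenLassoSolution {Ω : Type*} [MeasurableSpace Ω] {μ : Measure Ω}
    {n p : ℕ} {lam : ℝ} (hlam : 0 < lam)
    {X : Ω → Fin n → Fin p → ℝ} {y : Ω → Fin n → ℝ}
    (hmeas : AEMeasurable (fun ω => (X ω, y ω)) μ)
    (hac : (μ.map (fun ω => (X ω, y ω))) ≪
      (volume : Measure ((Fin n → Fin p → ℝ) × (Fin n → ℝ))))
    {ρ : Type*} [Fintype ρ] (D : Matrix ρ (Fin p) ℝ)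
    (hD : Module.finrank ℝ (LinearMap.ker D.mulVecLin) ≤ n) :
    ∀ᵐ ω ∂μ, HasUniqueGenLassoSolution lam (Matrix.of (X ω)) (y ω) D := by
  have hX : ∀ᵐ X : Fin n → Fin p → ℝ, ∀ y : Fin n → ℝ,
      HasUniqueGenLassoSolution lam (Matrix.of X) y D := by
    have hgen : ∀ᵐ X : Fin n → Fin p → ℝ, ∀ σ : ρ → SignType,
        (∃ h ∈ signFace D σ, signFunctional D σ h ≠ 0) →
        (∀ h ∈ signFace D σ, (Matrix.of X).mulVec h = 0 → h = 0) ∨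
        ¬ ∃ r : Fin n → ℝ, ∀ h ∈ signFace D σ,
          r ⬝ᵥ (Matrix.of X).mulVec h = signFunctional D σ h := by
      refine ae_all_iff.2 fun σ => ?_
      by_cases hσ : ∃ h ∈ signFace D σ, signFunctional D σ h ≠ 0
      · rcases le_or_gt (Module.finrank ℝ (signFace D σ)) n with hle | hlt
        · filter_upwards [ae_injOn_of_finrank_le _ hle] with X hX _ using Or.inl hX
        · filter_upwards [ae_not_mem_rowSpace_of_lt_finrank _ hlt _ hσ] with X hX _
            using Or.inr hX
      · exact Filter.Eventually.of_forall fun X h => absurd h hσ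
    filter_upwards [hgen, ae_injOn_of_finrank_le _ hD] with X h1 h2 y
    exact hasUniqueGenLassoSolution_of_generic hlam (fun h hh => h2 h hh) h1
  have hXy : ∀ᵐ z : (Fin n → Fin p → ℝ) × (Fin n → ℝ),
      HasUniqueGenLassoSolution lam (Matrix.of z.1) z.2 D := by
    filter_upwards [Measure.quasiMeasurePreserving_fst.ae hX] with z hz using hz z.2
  exact ae_of_ae_map hmeas (hac.ae_le hXy)

/-! ### Nullities of the penalty matrices -/

/-- If a kernel vector vanishing at the coordinates `s i` must be zero, the nullity is at most the
number of these coordinates. -/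
theorem finrank_ker_mulVecLin_le_card {ρ κ ι : Type*} [Fintype κ] [Fintype ι]
    (D : Matrix ρ κ ℝ) (s : ι → κ)
    (h : ∀ β : κ → ℝ, D.mulVec β = 0 → (∀ i, β (s i) = 0) → β = 0) :
    Module.finrank ℝ (LinearMap.ker D.mulVecLin) ≤ Fintype.card ι := by
  let T : LinearMap.ker D.mulVecLin →ₗ[ℝ] (ι → ℝ) :=
    LinearMap.funLeft ℝ ℝ s ∘ₗ (LinearMap.ker D.mulVecLin).subtype
  have hT : Function.Injective T := by
    refine (injective_iff_map_eq_zero T).2 fun a ha => ?_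
    exact Subtype.ext (h a a.2 fun i => congrFun ha i)
  simpa using LinearMap.finrank_le_finrank_of_injective hT

theorem firstDiffMatrix_mulVec (p : ℕ) (β : Fin p → ℝ) (i : Fin (p - 1)) :
    (firstDiffMatrix p).mulVec β i =
      β ⟨i.val + 1, by omega⟩ - β ⟨i.val, by omega⟩ := by
  have h : ∀ j : Fin p, firstDiffMatrix p i j * β j =
      (if j = ⟨i.val + 1, by omega⟩ then β j else 0) -
        (if j = ⟨i.val, by omega⟩ then β j else 0) := fun j => by
    simp only [firstDiffMatrix, Matrix.of_apply, Fin.ext_iff]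
    split_ifs <;> first | omega | ring
  simp only [Matrix.mulVec, dotProduct, h, Finset.sum_sub_distrib, Finset.sum_ite_eq',
    Finset.mem_univ, if_true]

theorem trendFilterMatrix_mulVec_succ (p k : ℕ) (β : Fin p → ℝ) (i : Fin (p - (k + 1) - 1)) :
    (trendFilterMatrix p (k + 1)).mulVec β i =
      (trendFilterMatrix p k).mulVec β ⟨i.val + 1, by omega⟩ -
        (trendFilterMatrix p k).mulVec β ⟨i.val, by omega⟩ := by
  have h : (trendFilterMatrix p (k + 1)).mulVec β =
      (firstDiffMatrix (p - k - 1)).mulVec ((trendFilterMatrix p k).mulVec β) := by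
    rw [Matrix.mulVec_mulVec]; rfl
  rw [h]
  exact firstDiffMatrix_mulVec _ _ ⟨i.val, by omega⟩

/-- Row `i` of the difference matrix of order `k + 1` is supported on the columns from `i` to
`i + k + 1`, and its entry in the last of these is `1`. -/
theorem trendFilterMatrix_mulVec_of_eq_zero (p k : ℕ) (β : Fin p → ℝ) (i : Fin (p - k - 1))
    (hβ : ∀ j : Fin p, j.val ≤ i.val + k → β j = 0) :
    (trendFilterMatrix p k).mulVec β i = β ⟨i.val + k + 1, by omega⟩ := by
  induction k with
  | zero =>
    refine (firstDiffMatrix_mulVec p β i).trans ?_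
    rw [hβ ⟨i.val, by omega⟩ (by simp), sub_zero]
  | succ k ih =>
    rw [trendFilterMatrix_mulVec_succ,
      ih ⟨i.val + 1, by omega⟩ fun j hj => hβ j (by simp only at hj; omega),
      ih ⟨i.val, by omega⟩ fun j hj => hβ j (by simp only at hj; omega),
      hβ ⟨i.val + k + 1, by omega⟩ (by simp only; omega), sub_zero]
    exact congrArg β (Fin.ext (by simp only; omega))

theorem eq_zero_of_trendFilterMatrix_mulVec_eq_zero {p k : ℕ} {β : Fin p → ℝ}
    (hβ : (trendFilterMatrix p k).mulVec β = 0) (h0 : ∀ j : Fin p, j.val ≤ k → β j = 0) :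
    β = 0 := by
  have h : ∀ (m : ℕ) (hm : m < p), β ⟨m, hm⟩ = 0 := by
    intro m
    induction m using Nat.strong_induction_on with
    | _ m ih =>
      intro hm
      rcases le_or_gt m k with hmk | hmk
      · exact h0 _ hmk
      · have h1 := trendFilterMatrix_mulVec_of_eq_zero p k β ⟨m - k - 1, by omega⟩
          fun j hj => ih j.val (by simp only at hj; omega) j.isLt
        rw [hβ] at h1
        rw [← Pi.zero_apply (M := fun _ => ℝ) (⟨m - k - 1, by omega⟩ : Fin (p - k - 1)), h1]
        congr 1
        simp only [Fin.mk.injEq]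
        omega
  exact funext fun j => h j.val j.isLt

theorem finrank_ker_trendFilterMatrix_le (p k : ℕ) :
    Module.finrank ℝ (LinearMap.ker (trendFilterMatrix p k).mulVecLin) ≤ k + 1 := by
  refine (finrank_ker_mulVecLin_le_card (ι := {j : Fin p // j.val < k + 1}) _ Subtype.val
    fun β hβ h0 => eq_zero_of_trendFilterMatrix_mulVec_eq_zero hβ fun j hj =>
      h0 ⟨j, Nat.lt_succ_of_le hj⟩).trans ?_
  simpa using Fintype.card_le_of_injective
    (fun j : {j : Fin p // j.val < k + 1} => (⟨j.1.val, j.2⟩ : Fin (k + 1)))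
    fun a b hab => Subtype.ext (Fin.ext (Fin.mk.inj hab))

/-- Block `j` of the Kronecker trend filtering matrix applies the one-dimensional difference
matrix along the grid lines in direction `j`. -/
theorem kroneckerTrendFilterMatrix_mulVec (N d k : ℕ) (β : (Fin d → Fin N) → ℝ) (j : Fin d)
    (i : Fin (N - k - 1)) (x : Fin d → Fin N) :
    (kroneckerTrendFilterMatrix N d k).mulVec β ⟨j, i, fun l => x l⟩ =
      (trendFilterMatrix N k).mulVec (fun t => β (Function.update x j t)) i := by
  have hinj : Function.Injective fun t : Fin N => Function.update x j t :=
    Function.update_injective x j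
  simp only [Matrix.mulVec, dotProduct]
  refine (Fintype.sum_of_injective _ hinj _ _ (fun z hz => ?_) fun t => ?_).symm
  · have hne : ∃ l : {l : Fin d // l ≠ j}, x l ≠ z l := by
      by_contra! hcon
      refine hz ⟨z j, funext fun l => ?_⟩
      by_cases hl : l = j
      · subst hl; simp
      · simpa [hl] using hcon ⟨l, hl⟩
    obtain ⟨l, hl⟩ := hne
    have : ∏ l : {l : Fin d // l ≠ j}, (1 : Matrix (Fin N) (Fin N) ℝ) (x l) (z l) = 0 :=
      Finset.prod_eq_zero (Finset.mem_univ l) (Matrix.one_apply_ne hl)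
    simp only [kroneckerTrendFilterMatrix, Matrix.of_apply, this, mul_zero, zero_mul]
  · have : ∏ l : {l : Fin d // l ≠ j},
        (1 : Matrix (Fin N) (Fin N) ℝ) (x l) (Function.update x j t l) = 1 :=
      Finset.prod_eq_one fun l _ => by rw [Function.update_of_ne l.2, Matrix.one_apply_eq]
    simp only [kroneckerTrendFilterMatrix, Matrix.of_apply, this, mul_one,
      Function.update_self]

/-- The zeros spread from the corner cube to the whole grid by freeing one coordinate at a time:
a grid line in the newly freed direction is annihilated by the one-dimensional difference matrix
and starts with `k + 1` zeros. -/
theorem eq_zero_of_kroneckerTrendFilterMatrix_mulVec_eq_zero {N d k : ℕ}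
    {β : (Fin d → Fin N) → ℝ} (hβ : (kroneckerTrendFilterMatrix N d k).mulVec β = 0)
    (h0 : ∀ x : Fin d → Fin N, (∀ i, (x i).val ≤ k) → β x = 0) : β = 0 := by
  have h : ∀ (S : Finset (Fin d)) (x : Fin d → Fin N), (∀ i ∉ S, (x i).val ≤ k) → β x = 0 := by
    intro S
    induction S using Finset.induction_on with
    | empty => exact fun x hx => h0 x fun i => hx i (Finset.notMem_empty i)
    | insert j S _ ih =>
      intro x hx
      have hline : (fun t => β (Function.update x j t)) = 0 := by
        refine eq_zero_of_trendFilterMatrix_mulVec_eq_zero (k := k) (funext fun i => ?_)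
          fun t ht => ih _ fun i hi => ?_
        · rw [← kroneckerTrendFilterMatrix_mulVec, hβ]
          rfl
        · by_cases hij : i = j
          · subst hij; simpa using ht
          · rw [Function.update_of_ne hij]
            exact hx i (by simp [hij, hi])
      simpa using congrFun hline (x j)
  exact funext fun x => h Finset.univ x fun i hi => absurd (Finset.mem_univ i) hi

theorem finrank_ker_kroneckerTrendFilterMatrix_le {p N d k : ℕ} (e : Fin p ≃ (Fin d → Fin N)) :
    Module.finrank ℝ (LinearMap.ker
      ((kroneckerTrendFilterMatrix N d k).submatrix id e).mulVecLin) ≤ (k + 1) ^ d := by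
  refine (finrank_ker_mulVecLin_le_card (ι := {x : Fin d → Fin N // ∀ i, (x i).val < k + 1})
    _ (fun x => e.symm x) fun β hβ h0 => ?_).trans ?_
  · have hβ' : (kroneckerTrendFilterMatrix N d k).mulVec (β ∘ e.symm) = 0 := by
      rw [Matrix.submatrix_mulVec_equiv] at hβ
      exact hβ
    have := eq_zero_of_kroneckerTrendFilterMatrix_mulVec_eq_zero hβ'
      fun x hx => h0 ⟨x, fun i => Nat.lt_succ_of_le (hx i)⟩
    funext v
    simpa using congrFun this (e v)
  · simpa using Fintype.card_le_of_injective
      (fun (x : {x : Fin d → Fin N // ∀ i, (x i).val < k + 1}) (i : Fin d) =>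
        (⟨(x.1 i).val, x.2 i⟩ : Fin (k + 1)))
      fun a b hab => Subtype.ext (funext fun i => Fin.ext (Fin.mk.inj (congrFun hab i)))

/-- A kernel vector is constant along edges, hence on connected components. -/
theorem IsGraphFusedLassoMatrix.finrank_ker_le {m p : ℕ} {G : SimpleGraph (Fin p)}
    {D : Matrix (Fin m) (Fin p) ℝ} (hD : IsGraphFusedLassoMatrix G D) :
    Module.finrank ℝ (LinearMap.ker D.mulVecLin) ≤ Nat.card G.ConnectedComponent := by
  classical
  obtain ⟨tail, head, -, hrange, hrow⟩ := hD
  have : Fintype G.ConnectedComponent := Fintype.ofFinite _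
  rw [Nat.card_eq_fintype_card]
  refine finrank_ker_mulVecLin_le_card D (fun c : G.ConnectedComponent => c.out)
    fun β hβ h0 => ?_
  have hmul : ∀ l, D.mulVec β l = β (head l) - β (tail l) := fun l => by
    simp [Matrix.mulVec, dotProduct, hrow, sub_mul, Finset.sum_sub_distrib]
  have hadj : ∀ u v, G.Adj u v → β u = β v := fun u v huv => by
    have : s(u, v) ∈ Set.range fun l => s(tail l, head l) := hrange ▸ huv
    obtain ⟨l, hl⟩ := this
    have h1 : β (head l) - β (tail l) = 0 := by rw [← hmul, hβ]; rfl
    rcases Sym2.eq_iff.1 hl with ⟨rfl, rfl⟩ | ⟨rfl, rfl⟩ <;> linarith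
  have hwalk : ∀ u v, G.Walk u v → β u = β v := fun u v w => by
    induction w with
    | nil => rfl
    | cons h _ ih => exact (hadj _ _ h).trans ih
  funext v
  have hreach : G.Reachable (G.connectedComponentMk v).out v :=
    SimpleGraph.ConnectedComponent.eq.1 (Quot.out_eq _)
  obtain ⟨w⟩ := hreach
  rw [← hwalk _ _ w, h0, Pi.zero_apply]

/-- Every factor beyond the first is harmless for the kernel, because `ker (Δᵀ Δ) = ker Δ`. -/
theorem graphTrendFilterMatrix_mulVec_eq_zero (k : ℕ) : ∀ {m p : ℕ}
    (Δ : Matrix (Fin m) (Fin p) ℝ) {β : Fin p → ℝ},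
    (graphTrendFilterMatrix Δ k).mulVec β = 0 → Δ.mulVec β = 0 := by
  induction k with
  | zero => exact fun Δ β h => h
  | succ k ih =>
    intro m p Δ β h
    have h1 : (graphTrendFilterMatrix Δ.transpose k).mulVec (Δ.mulVec β) = 0 := by
      rw [Matrix.mulVec_mulVec]; exact h
    have h2 := ih Δ.transpose h1
    have h3 : β ∈ LinearMap.ker (Δ.transpose * Δ).mulVecLin := by
      rw [LinearMap.mem_ker, Matrix.mulVecLin_apply, ← Matrix.mulVec_mulVec]
      exact h2
    rw [Matrix.ker_mulVecLin_transpose_mul_self] at h3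
    exact h3

theorem finrank_ker_graphTrendFilterMatrix_le {m p : ℕ} (Δ : Matrix (Fin m) (Fin p) ℝ) (k : ℕ) :
    Module.finrank ℝ (LinearMap.ker (graphTrendFilterMatrix Δ k).mulVecLin) ≤
      Module.finrank ℝ (LinearMap.ker Δ.mulVecLin) :=
  Submodule.finrank_mono fun _ h => graphTrendFilterMatrix_mulVec_eq_zero k Δ h

/-! ### The six penalties -/

theorem corollary1 {Ω : Type*} [MeasurableSpace Ω] (μ : Measure Ω) [IsProbabilityMeasure μ]
    (n p : ℕ) (lam : ℝ) (hlam : 0 < lam)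
    (X : Ω → Fin n → Fin p → ℝ) (y : Ω → Fin n → ℝ)
    (hmeas : AEMeasurable (fun ω => (X ω, y ω)) μ)
    -- the joint law of `(X, y)` is absolutely continuous w.r.t. Lebesgue measure
    (hac : (μ.map (fun ω => (X ω, y ω))) ≪
      (volume : Measure ((Fin n → Fin p → ℝ) × (Fin n → ℝ)))) :
    -- (i) identity matrix (lasso)
    (∀ᵐ ω ∂μ, HasUniqueGenLassoSolution lam (Matrix.of (X ω)) (y ω)
      (1 : Matrix (Fin p) (Fin p) ℝ)) ∧
    -- (ii) first difference matrix (fused lasso)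
    (1 ≤ n → ∀ᵐ ω ∂μ, HasUniqueGenLassoSolution lam (Matrix.of (X ω)) (y ω)
      (firstDiffMatrix p)) ∧
    -- (iii) difference matrix of order `k + 1` (trend filtering)
    (∀ k : ℕ, k + 1 ≤ n → ∀ᵐ ω ∂μ, HasUniqueGenLassoSolution lam (Matrix.of (X ω)) (y ω)
      (trendFilterMatrix p k)) ∧
    -- (iv) graph fused lasso
    (∀ (G : SimpleGraph (Fin p)) (m : ℕ) (D : Matrix (Fin m) (Fin p) ℝ),
      IsGraphFusedLassoMatrix G D → Nat.card G.ConnectedComponent ≤ n →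
      ∀ᵐ ω ∂μ, HasUniqueGenLassoSolution lam (Matrix.of (X ω)) (y ω) D) ∧
    -- (v) graph trend filtering of order `k`
    (∀ (G : SimpleGraph (Fin p)) (m : ℕ) (Δ : Matrix (Fin m) (Fin p) ℝ) (k : ℕ),
      IsGraphFusedLassoMatrix G Δ → Nat.card G.ConnectedComponent ≤ n →
      ∀ᵐ ω ∂μ, HasUniqueGenLassoSolution lam (Matrix.of (X ω)) (y ω)
        (graphTrendFilterMatrix Δ k)) ∧
    -- (vi) Kronecker trend filtering of order `k` on the `d`-dimensional grid with `p = N ^ d`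
    -- points, under an arbitrary numbering `e` of the grid points
    (∀ (N d k : ℕ) (e : Fin p ≃ (Fin d → Fin N)), (k + 1) ^ d ≤ n →
      ∀ᵐ ω ∂μ, HasUniqueGenLassoSolution lam (Matrix.of (X ω)) (y ω)
        ((kroneckerTrendFilterMatrix N d k).submatrix id e)) := by
  have key {ρ : Type} [Fintype ρ] (D : Matrix ρ (Fin p) ℝ)
      (hD : Module.finrank ℝ (LinearMap.ker D.mulVecLin) ≤ n) :
      ∀ᵐ ω ∂μ, HasUniqueGenLassoSolution lam (Matrix.of (X ω)) (y ω) D :=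
    ae_hasUniqueGenLassoSolution hlam hmeas hac D hD
  refine ⟨key _ (by rw [Matrix.mulVecLin_one, LinearMap.ker_id, finrank_bot]; exact Nat.zero_le n), fun hn => ?_, fun k hk => ?_, fun G m D hD hr => ?_,
    fun G m Δ k hΔ hr => ?_, fun N d k e hn => ?_⟩
  · exact key _ ((finrank_ker_trendFilterMatrix_le p 0).trans hn)
  · exact key _ ((finrank_ker_trendFilterMatrix_le p k).trans hk)
  · exact key _ (hD.finrank_ker_le.trans hr)
  · exact key _ ((finrank_ker_graphTrendFilterMatrix_le Δ k).trans (hΔ.finrank_ker_le.trans hr))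
  · exact key _ ((finrank_ker_kroneckerTrendFilterMatrix_le e).trans hn)
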